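/- A tree-like tableau of size $n$ is a filling of a Young diagram (left-justified rows of weakly decreasing lengths, with no empty rows or columns) with $n$ points in distinct cells such that: the top left cell contains a point (the root point); every non-root pointed cell has either a pointed cell above it in the same column or a pointed cell to its left in the same row, but not both; every row and every column contains a point. Let $\mathcal T_n$ be the set of tree-like tableaux of size $n$. For $T\in\mathcal T_n$ let $top(T)$ and $left(T)$ be the numbers of non-root points in the first row and in the first column respectively, let $w(T)=a^{top(T)}b^{left(T)}$, and let $T_n(a,b)=\sum_{T\in\mathcal T_n}w(T)$. A non-occupied corner of $T$ is a cell without a point whose bottom and right edges both lie on the southeast border of the diagram; its weight is $w(noc)=w(T)$. Let $NOC_{a,1}(\mathcal T_n)$ be the set of non-occupied corners of the tableaux in $\mathcal T_n$ that have no point above them in the same column, except possibly in the first row, and that have at least one point to their left in the same row outside the first column. Let $NOC_{1,b}(\mathcal T_n)$ be the set of those that have no point to their left in the same row, except possibly in the first column, and that have at least one point above them in the same column outside the first row. **Proposition.** For every $n\ge 3$, $$f_n(a,b):=\sum_{noc\in NOC_{a,1}(\mathcal T_n)}w(noc)=\binom{n-2}{2}\cdot a\cdot T_{n-2}(a,b)$$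 and $$g_n(a,b):=\sum_{noc\in NOC_{1,b}(\mathcal T_n)}w(noc)=\binom{n-2}{2}\cdot b\cdot T_{n-2}(a,b).$$ These identities hold for $a,b$ in an arbitrary commutative ring, in particular as polynomial identities in $\mathbb Z[a,b]$. -/

import Mathlib

/-- A tree-like tableau: a filling of a Young diagram (English convention; cell `(i, j)` lies in
row `i` and column `j`, counted from `0`) with points.  As the diagram is a Young diagram, it has
no empty rows or columns: its rows are the `i` with `(i, 0) ∈ shape`, its columns are the `j`
with `(0, j) ∈ shape`. -/
@[ext]
structure TreeLikeTableau where
  /-- the underlying diagram -/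
  shape : YoungDiagram
  /-- the pointed cells -/
  points : Finset (ℕ × ℕ)
  points_subset : points ⊆ shape.cells
  /-- the top left cell is pointed -/
  root_mem : (0, 0) ∈ points
  /-- every non-root pointed cell has a pointed cell above it in its column, or a pointed cell to
  its left in its row, but not both -/
  parent : ∀ c ∈ points, c ≠ (0, 0) →
    Xor (∃ i < c.1, (i, c.2) ∈ points) (∃ j < c.2, (c.1, j) ∈ points)
  /-- every row has a pointed cell -/
  row_pointed : ∀ i, (i, 0) ∈ shape → ∃ j, (i, j) ∈ points
  /-- every column has a pointed cell -/
  col_pointed : ∀ j, (0, j) ∈ shape → ∃ i, (i, j) ∈ points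

namespace TreeLikeTableau

/-- The size: the number of points. -/
def size (T : TreeLikeTableau) : ℕ := T.points.card

/-- The number of non-root points in the first row. -/
def top (T : TreeLikeTableau) : ℕ := (T.points.filter fun c => c.1 = 0 ∧ c ≠ (0, 0)).card

/-- The number of non-root points in the first column. -/
def left (T : TreeLikeTableau) : ℕ := (T.points.filter fun c => c.2 = 0 ∧ c ≠ (0, 0)).card

/-- The weight `w(T) = a ^ top(T) * b ^ left(T)`. -/
def weight {R : Type*} [CommRing R] (a b : R) (T : TreeLikeTableau) : R :=
  a ^ T.top * b ^ T.left

/-- The corners: the cells whose bottom and right edges both lie on the southeast border, i.e.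
with no cell directly below and no cell directly to the right. -/
def corners (T : TreeLikeTableau) : Finset (ℕ × ℕ) :=
  T.shape.cells.filter fun c =>
    (c.1 + 1, c.2) ∉ T.shape.cells ∧ (c.1, c.2 + 1) ∉ T.shape.cells

/-- The corners that contain no point. -/
def nonOccupiedCorners (T : TreeLikeTableau) : Finset (ℕ × ℕ) :=
  T.corners.filter fun c => c ∉ T.points

/-- No point above `c` in the same column, except possibly in the first row. -/
def NoPointAbove (T : TreeLikeTableau) (c : ℕ × ℕ) : Prop :=
  ∀ i, 0 < i → i < c.1 → (i, c.2) ∉ T.points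

/-- No point to the left of `c` in the same row, except possibly in the first column. -/
def NoPointLeft (T : TreeLikeTableau) (c : ℕ × ℕ) : Prop :=
  ∀ j, 0 < j → j < c.2 → (c.1, j) ∉ T.points

theorem row_lt_size (T : TreeLikeTableau) {i j : ℕ} (h : (i, j) ∈ T.shape) : i < T.size := by
  have hsub : Finset.range (i + 1) ⊆ T.points.image Prod.fst := by
    intro k hk
    have hk' : k ≤ i := Nat.lt_succ_iff.mp (Finset.mem_range.mp hk)
    obtain ⟨l, hl⟩ := T.row_pointed k (T.shape.up_left_mem hk' (Nat.zero_le j) h)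
    exact Finset.mem_image.mpr ⟨(k, l), hl, rfl⟩
  have h1 := (Finset.card_le_card hsub).trans Finset.card_image_le
  rw [Finset.card_range] at h1
  exact h1

theorem col_lt_size (T : TreeLikeTableau) {i j : ℕ} (h : (i, j) ∈ T.shape) : j < T.size := by
  have hsub : Finset.range (j + 1) ⊆ T.points.image Prod.snd := by
    intro k hk
    have hk' : k ≤ j := Nat.lt_succ_iff.mp (Finset.mem_range.mp hk)
    obtain ⟨l, hl⟩ := T.col_pointed k (T.shape.up_left_mem (Nat.zero_le i) hk' h)
    exact Finset.mem_image.mpr ⟨(l, k), hl, rfl⟩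
  have h1 := (Finset.card_le_card hsub).trans Finset.card_image_le
  rw [Finset.card_range] at h1
  exact h1

theorem finite_size_eq (n : ℕ) : {T : TreeLikeTableau | T.size = n}.Finite := by
  let B : Finset (ℕ × ℕ) := Finset.range n ×ˢ Finset.range n
  refine Set.Finite.of_finite_image (f := fun T => (T.shape.cells, T.points))
    ((B.powerset ×ˢ B.powerset).finite_toSet.subset ?_) ?_
  · rintro _ ⟨T, hT, rfl⟩
    have hT' : T.size = n := hT
    have hc : T.shape.cells ⊆ B := by
      rintro ⟨i, j⟩ hij
      have hm : (i, j) ∈ T.shape := hij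
      exact Finset.mem_product.mpr ⟨Finset.mem_range.mpr (hT' ▸ T.row_lt_size hm),
        Finset.mem_range.mpr (hT' ▸ T.col_lt_size hm)⟩
    simp only [Finset.coe_product, Set.mem_prod, Finset.mem_coe, Finset.mem_powerset]
    exact ⟨hc, T.points_subset.trans hc⟩
  · intro T _ T' _ h
    simp only [Prod.mk.injEq] at h
    exact TreeLikeTableau.ext (YoungDiagram.ext h.1) h.2

end TreeLikeTableau

open Classical in
/-- `𝒯ₙ`: the set of tree-like tableaux of size `n`. -/
noncomputable def treeLikeTableaux (n : ℕ) : Finset TreeLikeTableau :=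
  (TreeLikeTableau.finite_size_eq n).toFinset

/-- `Tₙ(a, b)`: the sum of `w(T)` over the tree-like tableaux of size `n`. -/
noncomputable def tableauPoly {R : Type*} [CommRing R] (n : ℕ) (a b : R) : R :=
  ∑ T ∈ treeLikeTableaux n, T.weight a b

/-- `NOC(𝒯ₙ)`: the non-occupied corners in `𝒯ₙ`, each recorded together with its tableau. -/
noncomputable def NOC (n : ℕ) : Finset ((_ : TreeLikeTableau) × (ℕ × ℕ)) :=
  (treeLikeTableaux n).sigma fun T => T.nonOccupiedCorners

open Classical in
/-- `NOC_{a,1}(𝒯ₙ)`: no point above except in the first row, but not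
"no point to the left except in the first column". -/
noncomputable def NOCa1 (n : ℕ) : Finset ((_ : TreeLikeTableau) × (ℕ × ℕ)) :=
  (NOC n).filter fun x => x.1.NoPointAbove x.2 ∧ ¬ x.1.NoPointLeft x.2

open Classical in
/-- `NOC_{1,b}(𝒯ₙ)`: no point to the left except in the first column, but not
"no point above except in the first row". -/
noncomputable def NOC1b (n : ℕ) : Finset ((_ : TreeLikeTableau) × (ℕ × ℕ)) :=
  (NOC n).filter fun x => x.1.NoPointLeft x.2 ∧ ¬ x.1.NoPointAbove x.2

/-- `fₙ(a, b)`: the sum over `NOC_{a,1}(𝒯ₙ)` of the weights of the tableaux of the corners. -/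
noncomputable def nocF {R : Type*} [CommRing R] (n : ℕ) (a b : R) : R :=
  ∑ x ∈ NOCa1 n, x.1.weight a b

/-- `gₙ(a, b)`: the sum over `NOC_{1,b}(𝒯ₙ)` of the weights of the tableaux of the corners. -/
noncomputable def nocG {R : Type*} [CommRing R] (n : ℕ) (a b : R) : R :=
  ∑ x ∈ NOC1b n, x.1.weight a b

/-! Tableaux of size `n + 1`, for `n ≥ 1`, are encoded by pairs `(T, B)`, where `T` has size `n` and
`B` is a set of rows pointed in the first column of `T`. If `B` is empty, a single-cell pointed row
is added at the bottom (`addRow`). Otherwise the first column is doubled and the points in the rows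
of `B` move to the second copy, the topmost of them also staying in place (`splitCol`). In both
cases `top` grows by one exactly when `0 ∈ B`, and `left` becomes `T.left + 1 - B.card`. Summing
over `B` yields `T_{n+1}(a, b) = (a + b) T_n(a, b + 1)` (`tableauPoly_succ`).

The corners in question are those with no point above outside the first row (`emptyColCorners`),
minus those that also have none to the left outside the first column (`emptyCrossCorners`). Under
the encoding, corners of the first kind survive and those of the second kind survive when their row
is not in `B`. One new corner, of both kinds, appears only when `B = {0}` and the last row of `T`,
not the first row, has one cell (`Short`). Short tableaux are the images of `addRow`, so the new
corners contribute a multiple of `T_{n-1}(a, b)` to the sums for size `n + 1`.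

With `C_n` and `b X_n` the weighted counts of the two kinds, the recurrences `C_{n+3}(a, b) = (a +
b) C_{n+2}(a, b + 1) + a b T_{n+1}(a, b)` and `X_{n+3}(a, b) = (a + b) X_{n+2}(a, b + 1) + a
T_{n+1}(a, b)` are solved by `C_{n+2} = a (n b + n.choose 2) T_n` and `X_{n+2} = a n T_n`. The terms
in `n b` cancel in `f = C - b X`. Reflection in the diagonal turns `f` into `g`. -/

namespace TreeLikeTableau

/-- The rows whose cell in the first column is pointed. -/
def firstCol (T : TreeLikeTableau) : Finset ℕ :=
  (T.points.filter fun c => c.2 = 0).image Prod.fst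

theorem mem_firstCol {T : TreeLikeTableau} {i : ℕ} : i ∈ T.firstCol ↔ (i, 0) ∈ T.points := by
  simp [firstCol]

theorem zero_mem_firstCol (T : TreeLikeTableau) : 0 ∈ T.firstCol := mem_firstCol.2 T.root_mem

theorem mem_shape_of_mem_points {T : TreeLikeTableau} {c : ℕ × ℕ} (h : c ∈ T.points) :
    c ∈ T.shape := T.points_subset h

theorem ext_iff_mem {T T' : TreeLikeTableau} (hs : ∀ i j, (i, j) ∈ T.shape ↔ (i, j) ∈ T'.shape)
    (hp : ∀ i j, (i, j) ∈ T.points ↔ (i, j) ∈ T'.points) : T = T' := by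
  refine TreeLikeTableau.ext (YoungDiagram.ext ?_) ?_
  · ext ⟨i, j⟩
    exact hs i j
  · ext ⟨i, j⟩
    exact hp i j

/-! ### Adding a single-cell row, and its inverse -/

/-- Some row other than the first consists of a single cell. -/
def Short (T : TreeLikeTableau) : Prop := ∃ i, 0 < i ∧ (i, 0) ∈ T.shape ∧ (i, 1) ∉ T.shape

/-- Add at the bottom a row with a single, pointed, cell. -/
def addRow (T : TreeLikeTableau) : TreeLikeTableau where
  shape :=
    { cells := insert (T.shape.colLen 0, 0) T.shape.cells
      isLowerSet := by
        rintro ⟨i, j⟩ ⟨i', j'⟩ ⟨h1, h2⟩ h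
        simp only [Finset.coe_insert, Set.mem_insert_iff, Prod.mk.injEq, Finset.mem_coe,
          YoungDiagram.mem_cells] at h ⊢
        simp only at h1 h2
        rcases h with ⟨rfl, rfl⟩ | h
        · obtain rfl : j' = 0 := by omega
          rw [YoungDiagram.mem_iff_lt_colLen]
          omega
        · exact Or.inr (T.shape.up_left_mem h1 h2 h) }
  points := insert (T.shape.colLen 0, 0) T.points
  points_subset := Finset.insert_subset_insert _ T.points_subset
  root_mem := Finset.mem_insert_of_mem T.root_mem
  parent := by
    rintro ⟨i, j⟩ hc hne
    have hr : 0 < T.shape.colLen 0 :=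
      YoungDiagram.mem_iff_lt_colLen.1 (mem_shape_of_mem_points T.root_mem)
    simp only [Finset.mem_insert, Prod.mk.injEq] at hc ⊢
    rcases hc with ⟨rfl, rfl⟩ | hc
    · exact Or.inl ⟨⟨0, hr, Or.inr T.root_mem⟩, by simp⟩
    · have hi : i < T.shape.colLen 0 := YoungDiagram.mem_iff_lt_colLen.1
        (T.shape.up_left_mem le_rfl (Nat.zero_le j) (mem_shape_of_mem_points hc))
      have h := T.parent _ hc hne
      -- The new cell lies strictly below every old row, so it is never the parent of an old point.
      have e1 : (∃ k < i, k = T.shape.colLen 0 ∧ j = 0 ∨ (k, j) ∈ T.points) ↔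
          ∃ k < i, (k, j) ∈ T.points :=
        exists_congr fun k => and_congr_right fun hk => ⟨fun h => h.resolve_left (by omega), Or.inr⟩
      have e2 : (∃ l < j, i = T.shape.colLen 0 ∧ l = 0 ∨ (i, l) ∈ T.points) ↔
          ∃ l < j, (i, l) ∈ T.points :=
        exists_congr fun k => and_congr_right fun hk => ⟨fun h => h.resolve_left (by omega), Or.inr⟩
      simpa only [e1, e2] using h
  row_pointed := by
    intro i hi
    rcases Finset.mem_insert.1 hi with h | h
    · exact ⟨0, Finset.mem_insert.2 (Or.inl h)⟩
    · obtain ⟨j, hj⟩ := T.row_pointed i h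
      exact ⟨j, Finset.mem_insert_of_mem hj⟩
  col_pointed := by
    intro j hj
    rcases Finset.mem_insert.1 hj with h | h
    · obtain rfl : j = 0 := (Prod.mk.inj h).2
      exact ⟨0, Finset.mem_insert_of_mem T.root_mem⟩
    · obtain ⟨i, hi⟩ := T.col_pointed j h
      exact ⟨i, Finset.mem_insert_of_mem hi⟩

theorem mem_shape_addRow {T : TreeLikeTableau} {i j : ℕ} :
    (i, j) ∈ T.addRow.shape ↔ (i = T.shape.colLen 0 ∧ j = 0) ∨ (i, j) ∈ T.shape := by
  rw [← YoungDiagram.mem_cells, ← YoungDiagram.mem_cells]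
  simp [addRow]

theorem mem_points_addRow {T : TreeLikeTableau} {i j : ℕ} :
    (i, j) ∈ T.addRow.points ↔ (i = T.shape.colLen 0 ∧ j = 0) ∨ (i, j) ∈ T.points := by
  simp [addRow]

theorem colLen_addRow (T : TreeLikeTableau) :
    T.addRow.shape.colLen 0 = T.shape.colLen 0 + 1 := by
  refine eq_of_forall_lt_iff fun i => ?_
  rw [← YoungDiagram.mem_iff_lt_colLen, mem_shape_addRow, YoungDiagram.mem_iff_lt_colLen]
  omega

theorem addRow_injective : Function.Injective addRow := by
  intro T T' h
  have hr : T.shape.colLen 0 = T'.shape.colLen 0 := by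
    have := colLen_addRow T
    rw [h, colLen_addRow] at this
    omega
  have hT : ∀ U : TreeLikeTableau, (U.shape.colLen 0, 0) ∉ U.shape := fun U hU =>
    lt_irrefl _ (YoungDiagram.mem_iff_lt_colLen.1 hU)
  refine ext_iff_mem (fun i j => ?_) fun i j => ?_
  · have e := mem_shape_addRow (T := T) (i := i) (j := j)
    rw [h, mem_shape_addRow, hr] at e
    by_cases hc : i = T'.shape.colLen 0 ∧ j = 0
    · obtain ⟨rfl, rfl⟩ := hc
      exact iff_of_false (hr ▸ hT T) (hT T')
    · simpa only [hc, false_or, iff_comm] using e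
  · have e := mem_points_addRow (T := T) (i := i) (j := j)
    rw [h, mem_points_addRow, hr] at e
    by_cases hc : i = T'.shape.colLen 0 ∧ j = 0
    · obtain ⟨rfl, rfl⟩ := hc
      exact iff_of_false (fun h => hT T (hr ▸ mem_shape_of_mem_points h))
        fun h => hT T' (mem_shape_of_mem_points h)
    · simpa only [hc, false_or, iff_comm] using e

theorem short_addRow (T : TreeLikeTableau) : T.addRow.Short := by
  refine ⟨T.shape.colLen 0, YoungDiagram.mem_iff_lt_colLen.1 (mem_shape_of_mem_points T.root_mem),
    mem_shape_addRow.2 (Or.inl ⟨rfl, rfl⟩), fun h => ?_⟩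
  rcases mem_shape_addRow.1 h with h | h
  · omega
  · exact lt_irrefl _ (YoungDiagram.mem_iff_lt_colLen.1
      (T.shape.up_left_mem le_rfl (Nat.zero_le 1) h))

/-- Row lengths decrease weakly, so one single-cell row below the first forces the last row to be
single-cell. Its cell is pointed because its row must be, and it is the parent of no other point, so
it can be erased. -/
theorem exists_addRow_eq {T : TreeLikeTableau} (hT : T.Short) : ∃ U : TreeLikeTableau,
    U.addRow = T := by
  obtain ⟨i, hi, hi0, hi1⟩ := hT
  obtain ⟨r, hr⟩ : ∃ r, T.shape.colLen 0 = r + 1 :=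
    Nat.exists_eq_succ_of_ne_zero (by
      have := YoungDiagram.mem_iff_lt_colLen.1 hi0
      omega)
  have hmem : ∀ k, (k, 0) ∈ T.shape ↔ k ≤ r := fun k => by
    rw [YoungDiagram.mem_iff_lt_colLen]
    omega
  have hir : i ≤ r := (hmem i).1 hi0
  have hr1 : ∀ j, (r, j) ∈ T.shape → j = 0 := fun j hj => by
    by_contra h0
    exact hi1 (T.shape.up_left_mem hir (Nat.one_le_iff_ne_zero.2 h0) hj)
  have hrp : (r, 0) ∈ T.points := by
    obtain ⟨j, hj⟩ := T.row_pointed r ((hmem r).2 le_rfl)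
    obtain rfl := hr1 j (mem_shape_of_mem_points hj)
    exact hj
  let U : TreeLikeTableau :=
    { shape :=
        { cells := T.shape.cells.erase (r, 0)
          isLowerSet := by
            rintro ⟨k, j⟩ ⟨k', j'⟩ ⟨h1, h2⟩ h
            simp only [Finset.coe_erase, Set.mem_sdiff, Finset.mem_coe, YoungDiagram.mem_cells,
              Set.mem_singleton_iff, Prod.mk.injEq] at h ⊢
            simp only at h1 h2
            refine ⟨T.shape.up_left_mem h1 h2 h.1, ?_⟩
            rintro ⟨rfl, rfl⟩
            have hk := (hmem k).1 (T.shape.up_left_mem le_rfl (Nat.zero_le j) h.1)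
            obtain rfl : k = k' := by omega
            exact h.2 ⟨rfl, hr1 j h.1⟩ }
      points := T.points.erase (r, 0)
      points_subset := Finset.erase_subset_erase _ T.points_subset
      root_mem := Finset.mem_erase.2 ⟨by simp only [ne_eq, Prod.mk.injEq]; omega, T.root_mem⟩
      parent := by
        rintro ⟨k, j⟩ hc hne
        simp only [Finset.mem_erase, ne_eq, Prod.mk.injEq] at hc ⊢
        have hk := (hmem k).1 (T.shape.up_left_mem le_rfl (Nat.zero_le j)
          (mem_shape_of_mem_points hc.2))
        have hkr : k ≠ r := by
          rintro rfl
          exact hc.1 ⟨rfl, hr1 j (mem_shape_of_mem_points hc.2)⟩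
        have h := T.parent _ hc.2 hne
        have e1 : (∃ l < k, ¬(l = r ∧ j = 0) ∧ (l, j) ∈ T.points) ↔
            ∃ l < k, (l, j) ∈ T.points :=
          exists_congr fun l => and_congr_right fun hl => ⟨And.right, fun h => ⟨by omega, h⟩⟩
        have e2 : (∃ l < j, ¬(k = r ∧ l = 0) ∧ (k, l) ∈ T.points) ↔
            ∃ l < j, (k, l) ∈ T.points :=
          exists_congr fun l => and_congr_right fun hl => ⟨And.right, fun h => ⟨by omega, h⟩⟩
        simpa only [e1, e2] using h
      row_pointed := by
        intro k hk
        have hk' := Finset.mem_erase.1 hk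
        obtain ⟨j, hj⟩ := T.row_pointed k hk'.2
        refine ⟨j, Finset.mem_erase.2 ⟨?_, hj⟩⟩
        rintro h
        simp only [Prod.mk.injEq] at h
        exact hk'.1 (by rw [h.1])
      col_pointed := by
        intro j hj
        rcases Nat.eq_zero_or_pos j with rfl | hj0
        · exact ⟨0, Finset.mem_erase.2 ⟨by simp only [ne_eq, Prod.mk.injEq]; omega, T.root_mem⟩⟩
        · obtain ⟨k, hk⟩ := T.col_pointed j (Finset.mem_erase.1 hj).2
          exact ⟨k, Finset.mem_erase.2 ⟨by simp only [ne_eq, Prod.mk.injEq]; omega, hk⟩⟩ }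
  have hUs : ∀ k j, (k, j) ∈ U.shape ↔ ¬(k = r ∧ j = 0) ∧ (k, j) ∈ T.shape := fun k j => by
    rw [← YoungDiagram.mem_cells, ← YoungDiagram.mem_cells]
    simp [U]
  have hUr : U.shape.colLen 0 = r := by
    refine eq_of_forall_lt_iff fun k => ?_
    rw [← YoungDiagram.mem_iff_lt_colLen, hUs, hmem]
    omega
  refine ⟨U, ext_iff_mem (fun k j => ?_) fun k j => ?_⟩
  · rw [mem_shape_addRow, hUs, hUr]
    by_cases h : k = r ∧ j = 0
    · simpa [h] using (hmem r).2 le_rfl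
    · simp only [h, false_or, not_false_eq_true, true_and]
  · rw [mem_points_addRow, hUr]
    by_cases h : k = r ∧ j = 0
    · simpa [h] using hrp
    · simp [U, h]

/-! ### Splitting the first column, and its inverse -/

/-- The rows pointed in the first column once the points of the rows of `B` have been moved to a
new second column: the topmost of them keeps a point in the first column as well. -/
def keptRows (T : TreeLikeTableau) (B : Finset ℕ) : Finset ℕ :=
  T.firstCol.filter fun i => i ∈ B → ∀ k ∈ B, i ≤ k

theorem mem_keptRows {T : TreeLikeTableau} {B : Finset ℕ} {i : ℕ} :
    i ∈ T.keptRows B ↔ (i, 0) ∈ T.points ∧ (i ∈ B → ∀ k ∈ B, i ≤ k) := by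
  simp [keptRows, mem_firstCol]

/-- The points of `splitCol`. -/
def splitPoints (T : TreeLikeTableau) (B : Finset ℕ) : Finset (ℕ × ℕ) :=
  (T.keptRows B ×ˢ {0} ∪ B ×ˢ {1}) ∪
    (T.points.filter fun c => 0 < c.2).image fun c => (c.1, c.2 + 1)

theorem mem_splitPoints_zero {T : TreeLikeTableau} {B : Finset ℕ} {i : ℕ} :
    (i, 0) ∈ T.splitPoints B ↔ i ∈ T.keptRows B := by
  simp [splitPoints]

theorem mem_splitPoints_one {T : TreeLikeTableau} {B : Finset ℕ} {i : ℕ} :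
    (i, 1) ∈ T.splitPoints B ↔ i ∈ B := by
  simp only [splitPoints, Finset.mem_union, Finset.mem_product, Finset.mem_singleton,
    Finset.mem_image, Finset.mem_filter, Prod.mk.injEq, Prod.exists]
  constructor
  · rintro ((h | h) | ⟨_, _, h⟩)
    · omega
    · exact h.1
    · omega
  · exact fun h => Or.inl (Or.inr ⟨h, trivial⟩)

theorem mem_splitPoints_add_two {T : TreeLikeTableau} {B : Finset ℕ} {i j : ℕ} :
    (i, j + 2) ∈ T.splitPoints B ↔ (i, j + 1) ∈ T.points := by
  simp only [splitPoints, Finset.mem_union, Finset.mem_product, Finset.mem_singleton,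
    Finset.mem_image, Finset.mem_filter, Prod.mk.injEq, Prod.exists]
  constructor
  · rintro ((h | h) | ⟨k, l, h1, rfl, h2⟩)
    · omega
    · omega
    · obtain rfl : l = j + 1 := by omega
      exact h1.1
  · exact fun h => Or.inr ⟨i, j + 1, ⟨h, by omega⟩, rfl, rfl⟩

/-- Double the first column, and move to the second copy the points of the rows of `B`, the
topmost of which is pointed in both. -/
def splitCol (T : TreeLikeTableau) (B : Finset ℕ) (hB : B.Nonempty) (hBC : B ⊆ T.firstCol) :
    TreeLikeTableau where
  shape :=
    { cells := T.shape.cells ∪ T.shape.cells.image fun c => (c.1, c.2 + 1)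
      isLowerSet := by
        rintro ⟨i, j⟩ ⟨i', j'⟩ ⟨h1, h2⟩ h
        simp only [Finset.coe_union, Set.mem_union, Finset.mem_coe, YoungDiagram.mem_cells,
          Finset.mem_image, Prod.mk.injEq, Prod.exists] at h ⊢
        simp only at h1 h2
        rcases h with h | ⟨k, l, h, rfl, rfl⟩
        · exact Or.inl (T.shape.up_left_mem h1 h2 h)
        · rcases j' with _ | j'
          · exact Or.inl (T.shape.up_left_mem h1 (Nat.zero_le _) h)
          · exact Or.inr ⟨i', j', T.shape.up_left_mem h1 (by omega) h, rfl, rfl⟩ }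
  points := T.splitPoints B
  points_subset := by
    have hC : ∀ i ∈ T.firstCol, (i, 0) ∈ T.shape := fun i hi =>
      mem_shape_of_mem_points (mem_firstCol.1 hi)
    rintro ⟨i, j⟩ h
    simp only [Finset.mem_union, YoungDiagram.mem_cells, Finset.mem_image, Prod.mk.injEq,
      Prod.exists]
    rcases j with _ | _ | j
    · exact Or.inl (mem_shape_of_mem_points (mem_keptRows.1 (mem_splitPoints_zero.1 h)).1)
    · exact Or.inr ⟨i, 0, hC i (hBC (mem_splitPoints_one.1 h)), rfl, rfl⟩
    · exact Or.inr ⟨i, j + 1, mem_shape_of_mem_points (mem_splitPoints_add_two.1 h), rfl, rfl⟩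
  root_mem := mem_splitPoints_zero.2 (mem_keptRows.2 ⟨T.root_mem, fun _ _ _ => Nat.zero_le _⟩)
  parent := by
    rintro ⟨i, j⟩ hc hne
    rcases j with _ | _ | j
    · refine Or.inl ⟨⟨0, ?_, mem_splitPoints_zero.2
        (mem_keptRows.2 ⟨T.root_mem, fun _ _ _ => Nat.zero_le _⟩)⟩, by simp⟩
      exact Nat.pos_of_ne_zero fun h => hne (Prod.ext h rfl)
    · have hi := mem_splitPoints_one.1 hc
      -- In the new column, the topmost point has its parent on the left; every other point has one
      -- above and, having left the first column, none on the left.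
      simp only [zero_add, mem_splitPoints_one, Nat.lt_one_iff, exists_eq_left,
        mem_splitPoints_zero, mem_keptRows, mem_firstCol.1 (hBC hi), hi, true_and, forall_const]
      by_cases h : ∃ k < i, k ∈ B
      · refine Or.inl ⟨h, fun h' => ?_⟩
        obtain ⟨k, hk, hkB⟩ := h
        exact absurd (h' k hkB) (by omega)
      · refine Or.inr ⟨fun k hk => ?_, h⟩
        by_contra hki
        exact h ⟨k, by omega, hk⟩
    · have h := T.parent _ (mem_splitPoints_add_two.1 hc) (by simp)
      -- A first-column point remains to the left of column `j + 2` whether it is moved or kept.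
      have e2 : (∃ l < j + 1 + 1, (i, l) ∈ T.splitPoints B) ↔ ∃ l < j + 1, (i, l) ∈ T.points := by
        constructor
        · rintro ⟨l, hl, hl'⟩
          rcases l with _ | _ | l
          · exact ⟨0, by omega, (mem_keptRows.1 (mem_splitPoints_zero.1 hl')).1⟩
          · exact ⟨0, by omega, mem_firstCol.1 (hBC (mem_splitPoints_one.1 hl'))⟩
          · exact ⟨l + 1, by omega, mem_splitPoints_add_two.1 hl'⟩
        · rintro ⟨l, hl, hl'⟩
          rcases l with _ | l
          · by_cases hi : i ∈ B
            · exact ⟨1, by omega, mem_splitPoints_one.2 hi⟩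
            · exact ⟨0, by omega, mem_splitPoints_zero.2
                (mem_keptRows.2 ⟨hl', fun h => absurd h hi⟩)⟩
          · exact ⟨l + 2, by omega, mem_splitPoints_add_two.2 hl'⟩
      simpa only [e2, mem_splitPoints_add_two] using h
  row_pointed := by
    intro i hi
    have hi' : (i, 0) ∈ T.shape := by
      rw [← YoungDiagram.mem_cells] at hi
      simpa using hi
    obtain ⟨j, hj⟩ := T.row_pointed i hi'
    rcases j with _ | j
    · by_cases hi : i ∈ B
      · exact ⟨1, mem_splitPoints_one.2 hi⟩
      · exact ⟨0, mem_splitPoints_zero.2 (mem_keptRows.2 ⟨hj, fun h => absurd h hi⟩)⟩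
    · exact ⟨j + 2, mem_splitPoints_add_two.2 hj⟩
  col_pointed := by
    intro j hj
    rcases j with _ | _ | j
    · exact ⟨0, mem_splitPoints_zero.2 (mem_keptRows.2 ⟨T.root_mem, fun _ _ _ => Nat.zero_le _⟩)⟩
    · obtain ⟨i, hi⟩ := hB
      exact ⟨i, mem_splitPoints_one.2 hi⟩
    · rw [← YoungDiagram.mem_cells] at hj
      simp only [Finset.mem_union, YoungDiagram.mem_cells, Finset.mem_image, Prod.mk.injEq,
        Prod.exists] at hj
      have hj' : (0, j + 1) ∈ T.shape := by
        rcases hj with h | ⟨k, l, h, rfl, h'⟩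
        · exact T.shape.up_left_mem le_rfl (by omega) h
        · obtain rfl : l = j + 1 := by omega
          exact h
      obtain ⟨i, hi⟩ := T.col_pointed _ hj'
      exact ⟨i, mem_splitPoints_add_two.2 hi⟩

section splitCol

variable {T : TreeLikeTableau} {B : Finset ℕ} {hB : B.Nonempty} {hBC : B ⊆ T.firstCol} {i j : ℕ}

theorem mem_shape_splitCol_zero :
    (i, 0) ∈ (T.splitCol B hB hBC).shape ↔ (i, 0) ∈ T.shape := by
  rw [← YoungDiagram.mem_cells, ← YoungDiagram.mem_cells]
  simp [splitCol]

theorem mem_shape_splitCol_succ :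
    (i, j + 1) ∈ (T.splitCol B hB hBC).shape ↔ (i, j) ∈ T.shape := by
  rw [← YoungDiagram.mem_cells, ← YoungDiagram.mem_cells]
  simp only [splitCol, Finset.mem_union, YoungDiagram.mem_cells, Finset.mem_image, Prod.mk.injEq,
    Prod.exists]
  constructor
  · rintro (h | ⟨k, l, h, rfl, h'⟩)
    · exact T.shape.up_left_mem le_rfl (by omega) h
    · obtain rfl : l = j := by omega
      exact h
  · exact fun h => Or.inr ⟨i, j, h, rfl, rfl⟩

theorem mem_points_splitCol_zero :
    (i, 0) ∈ (T.splitCol B hB hBC).points ↔ i ∈ T.keptRows B := mem_splitPoints_zero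

theorem mem_points_splitCol_one :
    (i, 1) ∈ (T.splitCol B hB hBC).points ↔ i ∈ B := mem_splitPoints_one

theorem mem_points_splitCol_add_two :
    (i, j + 2) ∈ (T.splitCol B hB hBC).points ↔ (i, j + 1) ∈ T.points := mem_splitPoints_add_two

theorem not_short_splitCol : ¬(T.splitCol B hB hBC).Short := by
  rintro ⟨i, -, h0, h1⟩
  exact h1 (mem_shape_splitCol_succ.2 (mem_shape_splitCol_zero.1 h0))

/-- Merging the first two columns undoes the splitting. -/
theorem mem_points_zero_iff_splitCol : (i, 0) ∈ T.points ↔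
    (i, 0) ∈ (T.splitCol B hB hBC).points ∨ (i, 1) ∈ (T.splitCol B hB hBC).points := by
  rw [mem_points_splitCol_zero, mem_points_splitCol_one, mem_keptRows]
  constructor
  · intro h
    by_cases hi : i ∈ B
    · exact Or.inr hi
    · exact Or.inl ⟨h, fun h => absurd h hi⟩
  · rintro (h | h)
    · exact h.1
    · exact mem_firstCol.1 (hBC h)

end splitCol

theorem splitCol_injective {T T' : TreeLikeTableau} {B B' : Finset ℕ} {hB : B.Nonempty}
    {hBC : B ⊆ T.firstCol} {hB' : B'.Nonempty} {hBC' : B' ⊆ T'.firstCol}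
    (h : T.splitCol B hB hBC = T'.splitCol B' hB' hBC') : T = T' ∧ B = B' := by
  refine ⟨ext_iff_mem (fun i j => ?_) fun i j => ?_, ?_⟩
  · rw [← mem_shape_splitCol_succ (hB := hB) (hBC := hBC), h, mem_shape_splitCol_succ]
  · rcases j with _ | j
    · rw [mem_points_zero_iff_splitCol (hB := hB) (hBC := hBC), h, ← mem_points_zero_iff_splitCol]
    · rw [← mem_points_splitCol_add_two (hB := hB) (hBC := hBC), h, mem_points_splitCol_add_two]
  · ext i
    rw [← mem_points_splitCol_one (hB := hB) (hBC := hBC), h, mem_points_splitCol_one]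

/-- Every row has at least two cells, so the first two columns have equal length and can be merged;
`B` is the set of rows pointed in the second. The exclusive parent condition makes the topmost row
of `B` the only one pointed in both columns. -/
theorem exists_splitCol_eq {T : TreeLikeTableau} (hT : ¬T.Short) (h01 : (0, 1) ∈ T.shape) :
    ∃ (U : TreeLikeTableau) (B : Finset ℕ) (hB : B.Nonempty) (hBC : B ⊆ U.firstCol),
      U.splitCol B hB hBC = T := by
  have hcol : ∀ i, (i, 0) ∈ T.shape → (i, 1) ∈ T.shape := fun i hi => by
    rcases Nat.eq_zero_or_pos i with rfl | h
    · exact h01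
    · by_contra h1
      exact hT ⟨i, h, hi, h1⟩
  -- Truncated subtraction sends columns `0` and `1` both to column `0`.
  have hs : ∀ i j, (i, j) ∈ T.shape.cells.image (fun c => (c.1, c.2 - 1)) ↔
      (i, j + 1) ∈ T.shape := fun i j => by
    simp only [Finset.mem_image, YoungDiagram.mem_cells, Prod.mk.injEq, Prod.exists]
    constructor
    · rintro ⟨k, l, h, rfl, rfl⟩
      rcases l with _ | l
      · exact hcol _ h
      · exact h
    · exact fun h => ⟨i, j + 1, h, rfl, rfl⟩
  have hp0 : ∀ i, (i, 0) ∈ T.points.image (fun c => (c.1, c.2 - 1)) ↔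
      (i, 0) ∈ T.points ∨ (i, 1) ∈ T.points := fun i => by
    simp only [Finset.mem_image, Prod.mk.injEq, Prod.exists]
    constructor
    · rintro ⟨k, l, h, rfl, hl⟩
      rcases l with _ | _ | l
      · exact Or.inl h
      · exact Or.inr h
      · omega
    · rintro (h | h)
      · exact ⟨i, 0, h, rfl, rfl⟩
      · exact ⟨i, 1, h, rfl, rfl⟩
  have hp1 : ∀ i j, (i, j + 1) ∈ T.points.image (fun c => (c.1, c.2 - 1)) ↔
      (i, j + 2) ∈ T.points := fun i j => by
    simp only [Finset.mem_image, Prod.mk.injEq, Prod.exists]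
    constructor
    · rintro ⟨k, l, h, rfl, hl⟩
      obtain rfl : l = j + 2 := by omega
      exact h
    · exact fun h => ⟨i, j + 2, h, rfl, rfl⟩
  let U : TreeLikeTableau :=
    { shape :=
        { cells := T.shape.cells.image fun c => (c.1, c.2 - 1)
          isLowerSet := by
            rintro ⟨i, j⟩ ⟨i', j'⟩ ⟨h1, h2⟩ h
            rw [Finset.mem_coe, hs] at h ⊢
            exact T.shape.up_left_mem h1 (Nat.succ_le_succ h2) h }
      points := T.points.image fun c => (c.1, c.2 - 1)
      points_subset := Finset.image_subset_image T.points_subset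
      root_mem := (hp0 0).2 (Or.inl T.root_mem)
      parent := by
        rintro ⟨i, j⟩ hc hne
        rcases j with _ | j
        · refine Or.inl ⟨⟨0, ?_, (hp0 0).2 (Or.inl T.root_mem)⟩, by simp⟩
          exact Nat.pos_of_ne_zero fun h => hne (Prod.ext h rfl)
        · have h := T.parent _ ((hp1 i j).1 hc) (by simp)
          have e2 : (∃ l < j + 1, (i, l) ∈ T.points.image (fun c => (c.1, c.2 - 1))) ↔
              ∃ l < j + 2, (i, l) ∈ T.points := by
            constructor
            · rintro ⟨l, hl, hl'⟩
              rcases l with _ | l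
              · rcases (hp0 i).1 hl' with h | h
                · exact ⟨0, by omega, h⟩
                · exact ⟨1, by omega, h⟩
              · exact ⟨l + 2, by omega, (hp1 i l).1 hl'⟩
            · rintro ⟨l, hl, hl'⟩
              rcases l with _ | _ | l
              · exact ⟨0, by omega, (hp0 i).2 (Or.inl hl')⟩
              · exact ⟨0, by omega, (hp0 i).2 (Or.inr hl')⟩
              · exact ⟨l + 1, by omega, (hp1 i l).2 hl'⟩
          simpa only [e2, hp1] using h
      row_pointed := by
        intro i hi
        obtain ⟨j, hj⟩ := T.row_pointed i
          (T.shape.up_left_mem le_rfl (Nat.zero_le 1) ((hs i 0).1 hi))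
        exact ⟨j - 1, Finset.mem_image_of_mem _ hj⟩
      col_pointed := by
        intro j hj
        obtain ⟨i, hi⟩ := T.col_pointed _ ((hs 0 j).1 hj)
        exact ⟨i, Finset.mem_image_of_mem _ hi⟩ }
  have hB : ∀ i, i ∈ (T.points.filter fun c => c.2 = 1).image Prod.fst ↔ (i, 1) ∈ T.points := by
    simp
  refine ⟨U, (T.points.filter fun c => c.2 = 1).image Prod.fst, ?_, ?_,
    ext_iff_mem (fun i j => ?_) fun i j => ?_⟩
  · obtain ⟨i, hi⟩ := T.col_pointed 1 h01
    exact ⟨i, (hB i).2 hi⟩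
  · intro i hi
    exact mem_firstCol.2 ((hp0 i).2 (Or.inr ((hB i).1 hi)))
  · rcases j with _ | j
    · rw [mem_shape_splitCol_zero]
      exact (hs i 0).trans ⟨T.shape.up_left_mem le_rfl (Nat.zero_le 1), hcol i⟩
    · rw [mem_shape_splitCol_succ]
      exact hs i j
  · rcases j with _ | _ | j
    · rw [mem_points_splitCol_zero, mem_keptRows]
      have hU : (i, 0) ∈ U.points ↔ _ := hp0 i
      simp only [hU, hB]
      have hxor : (i, 1) ∈ T.points → Xor (∃ k < i, (k, 1) ∈ T.points) ((i, 0) ∈ T.points) :=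
        fun h => by simpa using T.parent _ h (by simp)
      constructor
      · rintro ⟨h | h, h'⟩
        · exact h
        · rcases hxor h with ⟨⟨k, hk, hk1⟩, -⟩ | h''
          · exact absurd (h' h k hk1) (by omega)
          · exact h''.1
      · refine fun h => ⟨Or.inl h, fun h1 k hk => ?_⟩
        rcases hxor h1 with h'' | h''
        · exact absurd h h''.2
        · by_contra hki
          exact h''.2 ⟨k, by omega, hk⟩
    · rw [mem_points_splitCol_one]
      exact hB i
    · rw [mem_points_splitCol_add_two]
      exact hp1 i j

end TreeLikeTableau


/-! ### Size, `top` and `left` under the two operations -/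

namespace TreeLikeTableau

theorem card_firstCol (T : TreeLikeTableau) : T.firstCol.card = T.left + 1 := by
  have h : (T.points.filter fun c => c.2 = 0) =
      insert (0, 0) (T.points.filter fun c => c.2 = 0 ∧ c ≠ (0, 0)) := by
    ext c
    simp only [Finset.mem_filter, Finset.mem_insert]
    by_cases hc : c = (0, 0)
    · simp [hc, T.root_mem]
    · simp [hc]
  rw [firstCol, Finset.card_image_of_injOn, h, Finset.card_insert_of_notMem (by simp), left]
  rintro ⟨i, j⟩ hc ⟨i', j'⟩ hc' h
  simp only [Finset.coe_filter, Set.mem_ofPred_eq] at hc hc' h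
  rw [h, hc.2, hc'.2]

theorem left_eq (T : TreeLikeTableau) : T.left = T.firstCol.card - 1 := by
  rw [card_firstCol, Nat.add_sub_cancel]

theorem colLen_notMem (T : TreeLikeTableau) (j : ℕ) : (T.shape.colLen 0, j) ∉ T.shape := fun h =>
  lt_irrefl _ (YoungDiagram.mem_iff_lt_colLen.1 (T.shape.up_left_mem le_rfl (Nat.zero_le j) h))

theorem colLen_pos (T : TreeLikeTableau) : 0 < T.shape.colLen 0 :=
  YoungDiagram.mem_iff_lt_colLen.1 (mem_shape_of_mem_points T.root_mem)

theorem size_addRow (T : TreeLikeTableau) : T.addRow.size = T.size + 1 :=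
  Finset.card_insert_of_notMem fun h => T.colLen_notMem 0 (mem_shape_of_mem_points h)

theorem firstCol_addRow (T : TreeLikeTableau) :
    T.addRow.firstCol = insert (T.shape.colLen 0) T.firstCol := by
  ext i
  simp [mem_firstCol, mem_points_addRow]

theorem left_addRow (T : TreeLikeTableau) : T.addRow.left = T.left + 1 := by
  have h : T.shape.colLen 0 ∉ T.firstCol := fun h =>
    T.colLen_notMem 0 (mem_shape_of_mem_points (mem_firstCol.1 h))
  rw [left_eq, firstCol_addRow, Finset.card_insert_of_notMem h, card_firstCol, Nat.add_sub_cancel]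

theorem top_addRow (T : TreeLikeTableau) : T.addRow.top = T.top := by
  have hr := T.colLen_pos
  unfold top
  congr 1
  ext ⟨i, j⟩
  simp only [Finset.mem_filter, mem_points_addRow, ne_eq, Prod.mk.injEq]
  constructor
  · rintro ⟨h | h, h'⟩
    · omega
    · exact ⟨h, h'⟩
  · exact fun h => ⟨Or.inr h.1, h.2⟩

theorem keptRows_eq (T : TreeLikeTableau) {B : Finset ℕ} (hB : B.Nonempty) :
    T.keptRows B = T.firstCol \ B.erase (B.min' hB) := by
  ext i
  simp only [mem_keptRows, Finset.mem_sdiff, mem_firstCol, Finset.mem_erase, not_and']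
  refine and_congr_right fun _ => imp_congr_right fun hi => ?_
  rw [not_not]
  exact ⟨fun h => le_antisymm (h _ (B.min'_mem hB)) (B.min'_le i hi),
    fun h k hk => h ▸ B.min'_le k hk⟩

theorem card_keptRows_add (T : TreeLikeTableau) {B : Finset ℕ} (hB : B.Nonempty)
    (hBC : B ⊆ T.firstCol) : (T.keptRows B).card + B.card = T.firstCol.card + 1 := by
  have h1 := Finset.card_erase_add_one (B.min'_mem hB)
  have h2 := Finset.card_sdiff_add_card_eq_card ((Finset.erase_subset (B.min' hB) B).trans hBC)
  rw [keptRows_eq T hB]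
  omega

section splitCol

variable {T : TreeLikeTableau} {B : Finset ℕ} {hB : B.Nonempty} {hBC : B ⊆ T.firstCol}

theorem shiftCol_injective : Function.Injective fun c : ℕ × ℕ => (c.1, c.2 + 1) := by
  rintro ⟨i, j⟩ ⟨i', j'⟩ h
  simpa using h

/-- Points are only moved, except that the one in the topmost row of `B` is duplicated. -/
theorem size_splitCol : (T.splitCol B hB hBC).size = T.size + 1 := by
  have hT : T.size = T.firstCol.card + (T.points.filter fun c => 0 < c.2).card := by
    rw [size, ← Finset.card_filter_add_card_filter_not (s := T.points) (fun c => c.2 = 0)]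
    congr 1
    · refine (Finset.card_image_of_injOn ?_).symm
      rintro ⟨i, j⟩ hc ⟨i', j'⟩ hc' h
      simp only [Finset.coe_filter, Set.mem_ofPred_eq] at hc hc' h
      rw [h, hc.2, hc'.2]
    · simp only [Nat.pos_iff_ne_zero]
  have h1 : Disjoint (T.keptRows B ×ˢ ({0} : Finset ℕ)) (B ×ˢ {1}) := by
    rw [Finset.disjoint_left]
    rintro ⟨i, j⟩ h h'
    simp only [Finset.mem_product, Finset.mem_singleton] at h h'
    omega
  have h2 : Disjoint (T.keptRows B ×ˢ ({0} : Finset ℕ) ∪ B ×ˢ {1})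
      ((T.points.filter fun c => 0 < c.2).image fun c => (c.1, c.2 + 1)) := by
    rw [Finset.disjoint_left]
    rintro ⟨i, j⟩ h h'
    simp only [Finset.mem_union, Finset.mem_product, Finset.mem_singleton, Finset.mem_image,
      Finset.mem_filter, Prod.mk.injEq] at h h'
    obtain ⟨c, hc, -, hj⟩ := h'
    omega
  have h3 := card_keptRows_add T hB hBC
  change (T.splitPoints B).card = _
  rw [splitPoints, Finset.card_union_of_disjoint h2, Finset.card_union_of_disjoint h1,
    Finset.card_image_of_injective _ shiftCol_injective, Finset.card_product, Finset.card_product,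
    hT]
  simp only [Finset.card_singleton, mul_one]
  omega

theorem left_splitCol : (T.splitCol B hB hBC).left + B.card = T.left + 1 := by
  have h : (T.splitCol B hB hBC).firstCol = T.keptRows B := by
    ext i
    rw [mem_firstCol, mem_points_splitCol_zero]
  have h1 := card_firstCol (T.splitCol B hB hBC)
  have h2 := card_firstCol T
  have h3 := card_keptRows_add T hB hBC
  rw [h] at h1
  omega

/-- Row `0`, if in `B`, is its topmost row: the root stays and `(0, 1)` is gained. -/
theorem top_splitCol : (T.splitCol B hB hBC).top = T.top + if 0 ∈ B then 1 else 0 := by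
  have h : ((T.splitCol B hB hBC).points.filter fun c => c.1 = 0 ∧ c ≠ (0, 0)) =
      ((T.points.filter fun c => c.1 = 0 ∧ c ≠ (0, 0)).image fun c => (c.1, c.2 + 1)) ∪
        if 0 ∈ B then {(0, 1)} else ∅ := by
    have hs : ∀ i j, (i, j + 1) ∈ ((T.points.filter fun c => c.1 = 0 ∧ c ≠ (0, 0)).image
        fun c => (c.1, c.2 + 1)) ↔ (i, j) ∈ T.points.filter fun c => c.1 = 0 ∧ c ≠ (0, 0) :=
      fun i j => shiftCol_injective.mem_finset_image (a := (i, j))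
    ext ⟨i, j⟩
    rcases j with _ | _ | j
    · by_cases h0 : 0 ∈ B <;> simp +contextual [h0]
    · rw [Finset.mem_union, hs]
      by_cases h0 : 0 ∈ B <;>
        simp +contextual [h0, mem_points_splitCol_one]
      rintro h rfl
      exact h0 h
    · rw [Finset.mem_union, hs]
      by_cases h0 : 0 ∈ B <;> simp [h0, mem_points_splitCol_add_two]
  rw [top, h, Finset.card_union_of_disjoint, Finset.card_image_of_injective _ shiftCol_injective,
    top]
  · congr 1
    split_ifs <;> rfl
  · rw [Finset.disjoint_left]
    rintro ⟨i, j⟩ h h'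
    simp only [Finset.mem_image, Finset.mem_filter, Prod.mk.injEq] at h
    obtain ⟨⟨k, l⟩, ⟨-, h1, h2⟩, rfl, rfl⟩ := h
    split_ifs at h'
    · simp only [Finset.mem_singleton, Prod.mk.injEq] at h'
      exact h2 (Prod.ext h1 (by simpa using h'.2))
    · simp at h'

end splitCol

/-! ### The encoding of tableaux by pairs -/

/-- The tableau, one larger than `T`, encoded by `T` and a set `B` of rows pointed in the first
column. -/
noncomputable def child (T : TreeLikeTableau) (B : Finset ℕ) : TreeLikeTableau :=
  open Classical in
  if h : B.Nonempty ∧ B ⊆ T.firstCol then T.splitCol B h.1 h.2 else T.addRow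

theorem child_empty (T : TreeLikeTableau) : T.child ∅ = T.addRow := by
  simp [child]

theorem child_eq_splitCol {T : TreeLikeTableau} {B : Finset ℕ} (hB : B.Nonempty)
    (hBC : B ⊆ T.firstCol) : T.child B = T.splitCol B hB hBC := by
  simp [child, hB, hBC]

theorem size_child (T : TreeLikeTableau) (B : Finset ℕ) : (T.child B).size = T.size + 1 := by
  unfold child
  split_ifs
  · exact size_splitCol
  · exact size_addRow T

theorem top_child {T : TreeLikeTableau} {B : Finset ℕ} (hBC : B ⊆ T.firstCol) :
    (T.child B).top = T.top + if 0 ∈ B then 1 else 0 := by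
  rcases B.eq_empty_or_nonempty with rfl | hB
  · simp [child_empty, top_addRow]
  · rw [child_eq_splitCol hB hBC, top_splitCol]

theorem left_child {T : TreeLikeTableau} {B : Finset ℕ} (hBC : B ⊆ T.firstCol) :
    (T.child B).left = T.firstCol.card - B.card := by
  rw [card_firstCol]
  rcases B.eq_empty_or_nonempty with rfl | hB
  · simp [child_empty, left_addRow]
  · rw [child_eq_splitCol hB hBC]
    have := left_splitCol (hB := hB) (hBC := hBC)
    omega

theorem short_child_iff {T : TreeLikeTableau} {B : Finset ℕ} (hBC : B ⊆ T.firstCol) :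
    (T.child B).Short ↔ B = ∅ := by
  rcases B.eq_empty_or_nonempty with rfl | hB
  · simp [child_empty, short_addRow]
  · rw [child_eq_splitCol hB hBC]
    exact iff_of_false not_short_splitCol hB.ne_empty

/-- Shortness tells the two operations apart, and each of them is injective. -/
theorem child_injective {T T' : TreeLikeTableau} {B B' : Finset ℕ} (hBC : B ⊆ T.firstCol)
    (hBC' : B' ⊆ T'.firstCol) (h : T.child B = T'.child B') : T = T' ∧ B = B' := by
  have hs : B = ∅ ↔ B' = ∅ := by
    rw [← short_child_iff hBC, h, short_child_iff hBC']
  rcases B.eq_empty_or_nonempty with rfl | hB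
  · obtain rfl := hs.1 rfl
    rw [child_empty, child_empty] at h
    exact ⟨addRow_injective h, rfl⟩
  · have hB' : B'.Nonempty := Finset.nonempty_iff_ne_empty.2 fun h' => hB.ne_empty (hs.2 h')
    rw [child_eq_splitCol hB hBC, child_eq_splitCol hB' hBC'] at h
    exact splitCol_injective h

theorem exists_child_eq {T : TreeLikeTableau} (hT : 1 < T.size) :
    ∃ (U : TreeLikeTableau) (B : Finset ℕ), B ⊆ U.firstCol ∧ U.child B = T := by
  by_cases hs : T.Short
  · obtain ⟨U, hU⟩ := exists_addRow_eq hs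
    exact ⟨U, ∅, by simp, (child_empty U).trans hU⟩
  · by_cases h01 : (0, 1) ∈ T.shape
    · obtain ⟨U, B, hB, hBC, hU⟩ := exists_splitCol_eq hs h01
      exact ⟨U, B, hBC, (child_eq_splitCol hB hBC).trans hU⟩
    -- Not short and without a second column, the diagram is a single cell.
    · exfalso
      have hp : T.points ⊆ {(0, 0)} := by
        rintro ⟨i, j⟩ h
        have hc := mem_shape_of_mem_points h
        obtain rfl : j = 0 := by
          by_contra h0
          exact h01 (T.shape.up_left_mem (Nat.zero_le i) (Nat.one_le_iff_ne_zero.2 h0) hc)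
        obtain rfl : i = 0 := by
          by_contra h0
          exact hs ⟨i, Nat.pos_of_ne_zero h0, hc,
            fun h => h01 (T.shape.up_left_mem (Nat.zero_le i) le_rfl h)⟩
        simp
      have := Finset.card_le_card hp
      rw [Finset.card_singleton] at this
      exact absurd hT (not_lt.2 this)

theorem mem_treeLikeTableaux {T : TreeLikeTableau} {n : ℕ} :
    T ∈ treeLikeTableaux n ↔ T.size = n := by
  simp [treeLikeTableaux]

/-- Summation over the tableaux of size `n + 1` through their encoding by those of size `n`. -/
theorem sum_treeLikeTableaux_succ {M : Type*} [AddCommMonoid M] {n : ℕ} (hn : 1 ≤ n)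
    (φ : TreeLikeTableau → M) :
    ∑ T ∈ treeLikeTableaux (n + 1), φ T =
      ∑ T ∈ treeLikeTableaux n, ∑ B ∈ T.firstCol.powerset, φ (T.child B) := by
  rw [Finset.sum_sigma']
  symm
  refine Finset.sum_bij (fun x _ => x.1.child x.2) ?_ ?_ ?_ fun _ _ => rfl
  · rintro ⟨T, B⟩ h
    rw [Finset.mem_sigma, mem_treeLikeTableaux] at h
    rw [mem_treeLikeTableaux, size_child, h.1]
  · rintro ⟨T, B⟩ h ⟨T', B'⟩ h' e
    simp only [Finset.mem_sigma, Finset.mem_powerset] at h h' e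
    obtain ⟨rfl, rfl⟩ := child_injective h.2 h'.2 e
    rfl
  · intro T hT
    rw [mem_treeLikeTableaux] at hT
    obtain ⟨U, B, hB, rfl⟩ := exists_child_eq (T := T) (by omega)
    rw [size_child] at hT
    exact ⟨⟨U, B⟩, by simp only [Finset.mem_sigma, mem_treeLikeTableaux, Finset.mem_powerset]
                      exact ⟨by omega, hB⟩, rfl⟩

/-! ### Corners under the encoding -/

/-- The unoccupied corners in whose column only the first row may be pointed. -/
noncomputable def emptyColCorners (T : TreeLikeTableau) : Finset (ℕ × ℕ) :=
  open Classical in T.nonOccupiedCorners.filter T.NoPointAbove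

/-- A corner in the first row is alone in its column or has only that column's sole cell, hence is
pointed; likewise in the first column. Nothing lies below a corner, so emptiness above and of the
corner itself is emptiness of the column outside the first row. -/
theorem mem_emptyColCorners {T : TreeLikeTableau} {i j : ℕ} :
    (i, j) ∈ T.emptyColCorners ↔ (0 < i ∧ 0 < j) ∧ ((i, j) ∈ T.shape ∧ (i + 1, j) ∉ T.shape ∧
      (i, j + 1) ∉ T.shape) ∧ ∀ k, 0 < k → (k, j) ∉ T.points := by
  simp only [emptyColCorners, nonOccupiedCorners, corners, Finset.mem_filter, NoPointAbove,
    YoungDiagram.mem_cells]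
  constructor
  · rintro ⟨⟨⟨h, h1, h2⟩, hp⟩, ha⟩
    have hcol : ∀ k, (k, j) ∈ T.points → k ≤ i := fun k hk => by
      by_contra hki
      exact h1 (T.shape.up_left_mem (by omega) le_rfl (mem_shape_of_mem_points hk))
    have hrow : ∀ l, (i, l) ∈ T.points → l ≤ j := fun l hl => by
      by_contra hlj
      exact h2 (T.shape.up_left_mem le_rfl (by omega) (mem_shape_of_mem_points hl))
    refine ⟨⟨?_, ?_⟩, ⟨h, h1, h2⟩, fun k hk hkp => ?_⟩
    · rcases Nat.eq_zero_or_pos i with rfl | hi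
      · obtain ⟨k, hk⟩ := T.col_pointed j h
        obtain rfl : k = 0 := Nat.le_zero.1 (hcol k hk)
        exact absurd hk hp
      · exact hi
    · rcases Nat.eq_zero_or_pos j with rfl | hj
      · obtain ⟨l, hl⟩ := T.row_pointed i h
        obtain rfl : l = 0 := Nat.le_zero.1 (hrow l hl)
        exact absurd hl hp
      · exact hj
    · rcases (hcol k hkp).lt_or_eq with h' | rfl
      · exact ha k hk h' hkp
      · exact hp hkp
  · rintro ⟨⟨hi, -⟩, h, ha⟩
    exact ⟨⟨h, ha i hi⟩, fun k hk _ => ha k hk⟩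

/-- The unoccupied corners in whose column only the first row may be pointed and in whose row only
the first column may be pointed. -/
noncomputable def emptyCrossCorners (T : TreeLikeTableau) : Finset (ℕ × ℕ) :=
  open Classical in T.emptyColCorners.filter T.NoPointLeft

theorem mem_emptyCrossCorners {T : TreeLikeTableau} {i j : ℕ} :
    (i, j) ∈ T.emptyCrossCorners ↔ (i, j) ∈ T.emptyColCorners ∧
      ∀ l, 0 < l → (i, l) ∉ T.points := by
  simp only [emptyCrossCorners, Finset.mem_filter, NoPointLeft]
  refine and_congr_right fun h => ⟨fun hl l h0 hp => ?_, fun h l h0 _ => h l h0⟩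
  rw [mem_emptyColCorners] at h
  rcases lt_trichotomy l j with h' | rfl | h'
  · exact hl l h0 h' hp
  · exact h.2.2 i h.1.1 hp
  · exact h.2.1.2.2 (T.shape.up_left_mem le_rfl h' (mem_shape_of_mem_points hp))

theorem emptyCrossCorners_subset (T : TreeLikeTableau) :
    T.emptyCrossCorners ⊆ T.emptyColCorners := by
  classical exact Finset.filter_subset _ _

/-- The row must contain a point, and only its first cell is left for it. -/
theorem fst_mem_firstCol {T : TreeLikeTableau} {c : ℕ × ℕ} (h : c ∈ T.emptyCrossCorners) :
    c.1 ∈ T.firstCol ∧ 0 < c.1 := by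
  obtain ⟨i, j⟩ := c
  rw [mem_emptyCrossCorners, mem_emptyColCorners] at h
  obtain ⟨l, hl⟩ := T.row_pointed i (T.shape.up_left_mem le_rfl (Nat.zero_le j) h.1.2.1.1)
  rcases Nat.eq_zero_or_pos l with rfl | h0
  · exact ⟨mem_firstCol.2 hl, h.1.1.1⟩
  · exact absurd hl (h.2 l h0)

/-- The added cell is in the first column, which contains no such corner. -/
theorem emptyColCorners_addRow (T : TreeLikeTableau) :
    T.addRow.emptyColCorners = T.emptyColCorners := by
  ext ⟨i, j⟩
  rw [mem_emptyColCorners, mem_emptyColCorners]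
  refine and_congr_right fun h => ?_
  simp [mem_shape_addRow, mem_points_addRow, h.2.ne']

theorem emptyCrossCorners_addRow (T : TreeLikeTableau) :
    T.addRow.emptyCrossCorners = T.emptyCrossCorners := by
  ext ⟨i, j⟩
  rw [mem_emptyCrossCorners, mem_emptyCrossCorners, emptyColCorners_addRow]
  refine and_congr_right fun _ => forall_congr' fun l => imp_congr_right fun hl => ?_
  simp [mem_points_addRow, hl.ne']

/-- The corner created by `splitCol` in the second column when `T` is short and only the first row
is moved. -/
noncomputable def newCorner (T : TreeLikeTableau) (B : Finset ℕ) : Finset (ℕ × ℕ) :=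
  open Classical in if B = {0} ∧ T.Short then {(T.shape.colLen 0 - 1, 1)} else ∅

theorem mem_newCorner {T : TreeLikeTableau} {B : Finset ℕ} (hB : B.Nonempty) {i j : ℕ} :
    (i, j) ∈ T.newCorner B ↔ j = 1 ∧ 0 < i ∧ ((i, 0) ∈ T.shape ∧ (i + 1, 0) ∉ T.shape ∧
      (i, 1) ∉ T.shape) ∧ ∀ k, 0 < k → k ∉ B := by
  have hB0 : B = {0} ↔ ∀ k, 0 < k → k ∉ B := by
    rw [Finset.eq_singleton_iff_nonempty_unique_mem]
    refine ⟨fun h k hk hkB => by have := h.2 k hkB; omega, fun h => ⟨hB, fun k hk => ?_⟩⟩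
    by_contra h0
    exact h k (Nat.pos_of_ne_zero h0) hk
  have hr : ∀ k, (k, 0) ∈ T.shape ↔ k < T.shape.colLen 0 := fun _ =>
    YoungDiagram.mem_iff_lt_colLen
  unfold newCorner
  split_ifs with h
  · obtain ⟨h1, k, hk, hk0, hk1⟩ := h
    rw [Finset.mem_singleton, Prod.mk.injEq, hr, hr]
    rw [hr] at hk0
    constructor
    · rintro ⟨rfl, rfl⟩
      exact ⟨rfl, by omega, ⟨by omega, by omega,
        fun h => hk1 (T.shape.up_left_mem (by omega) le_rfl h)⟩, hB0.1 h1⟩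
    · rintro ⟨rfl, hi, h, -⟩
      exact ⟨by omega, rfl⟩
  · refine iff_of_false (by simp) ?_
    rintro ⟨rfl, hi, h', h0⟩
    exact h ⟨hB0.2 h0, i, hi, h'.1, h'.2.2⟩

theorem card_newCorner (T : TreeLikeTableau) (B : Finset ℕ) :
    (T.newCorner B).card = open Classical in if B = {0} ∧ T.Short then 1 else 0 := by
  unfold newCorner
  split_ifs <;> rfl

theorem disjoint_newCorner {T : TreeLikeTableau} {B : Finset ℕ} {s : Finset (ℕ × ℕ)}
    (hs : s ⊆ T.emptyColCorners) :
    Disjoint (s.image fun c => (c.1, c.2 + 1)) (T.newCorner B) := by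
  rw [Finset.disjoint_left]
  rintro c hc hc'
  obtain ⟨⟨i, j⟩, h, rfl⟩ := Finset.mem_image.1 hc
  have hj := (mem_emptyColCorners.1 (hs h)).1.2
  unfold newCorner at hc'
  split_ifs at hc'
  · simp only [Finset.mem_singleton, Prod.mk.injEq] at hc'
    omega
  · simp at hc'

section splitCol

variable {T : TreeLikeTableau} {B : Finset ℕ} {hB : B.Nonempty} {hBC : B ⊆ T.firstCol}

/-- Columns from the second on shift right unchanged. The doubled column ends in a corner when the
last row has one cell, and it is empty below the first row when `B = {0}`. -/
theorem emptyColCorners_splitCol : (T.splitCol B hB hBC).emptyColCorners =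
    T.emptyColCorners.image (fun c => (c.1, c.2 + 1)) ∪ T.newCorner B := by
  ext ⟨i, j⟩
  rw [Finset.mem_union, mem_newCorner hB]
  rcases j with _ | _ | j
  · rw [mem_emptyColCorners]
    simp
  · rw [shiftCol_injective.mem_finset_image (a := (i, 0)), mem_emptyColCorners,
      mem_emptyColCorners]
    simp [mem_shape_splitCol_succ, mem_points_splitCol_one]
  · rw [shiftCol_injective.mem_finset_image (a := (i, j + 1)), mem_emptyColCorners,
      mem_emptyColCorners]
    simp [mem_shape_splitCol_succ, mem_points_splitCol_add_two]

/-- A row of `B` acquires a point in the second column, which disqualifies its corner. -/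
theorem emptyCrossCorners_splitCol : (T.splitCol B hB hBC).emptyCrossCorners =
    (T.emptyCrossCorners.filter fun c => c.1 ∉ B).image (fun c => (c.1, c.2 + 1)) ∪
      T.newCorner B := by
  have key : ∀ i, (∀ l, 0 < l → (i, l) ∉ (T.splitCol B hB hBC).points) ↔
      i ∉ B ∧ ∀ l, 0 < l → (i, l) ∉ T.points := fun i => by
    constructor
    · refine fun h => ⟨fun hi => h 1 one_pos (mem_points_splitCol_one.2 hi), fun l hl hp => ?_⟩
      obtain ⟨l, rfl⟩ := Nat.exists_eq_succ_of_ne_zero hl.ne'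
      exact h (l + 2) (by omega) (mem_points_splitCol_add_two.2 hp)
    · rintro ⟨hi, h⟩ (_ | _ | l) hl hp
      · omega
      · exact hi (mem_points_splitCol_one.1 hp)
      · exact h (l + 1) (by omega) (mem_points_splitCol_add_two.1 hp)
  ext ⟨i, j⟩
  rw [mem_emptyCrossCorners, key, emptyColCorners_splitCol]
  simp only [Finset.mem_union]
  have hnew : (i, j) ∈ T.newCorner B → i ∉ B ∧ ∀ l, 0 < l → (i, l) ∉ T.points := fun h => by
    rw [mem_newCorner hB] at h
    exact ⟨h.2.2.2 i h.2.1, fun l hl hp =>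
      h.2.2.1.2.2 (T.shape.up_left_mem le_rfl hl (mem_shape_of_mem_points hp))⟩
  have himg : (i, j) ∈ (T.emptyCrossCorners.filter fun c => c.1 ∉ B).image
      (fun c => (c.1, c.2 + 1)) ↔ (i, j) ∈ T.emptyColCorners.image (fun c => (c.1, c.2 + 1)) ∧
        i ∉ B ∧ ∀ l, 0 < l → (i, l) ∉ T.points := by
    rcases j with _ | j
    · simp
    · rw [shiftCol_injective.mem_finset_image (a := (i, j)),
        shiftCol_injective.mem_finset_image (a := (i, j)), Finset.mem_filter,
        mem_emptyCrossCorners]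
      tauto
  rw [himg]
  tauto

end splitCol

theorem card_emptyColCorners_child {T : TreeLikeTableau} {B : Finset ℕ} (hBC : B ⊆ T.firstCol) :
    (T.child B).emptyColCorners.card = T.emptyColCorners.card + (T.newCorner B).card := by
  rcases B.eq_empty_or_nonempty with rfl | hB
  · simp [child_empty, emptyColCorners_addRow, newCorner]
  · rw [child_eq_splitCol hB hBC, emptyColCorners_splitCol,
      Finset.card_union_of_disjoint (disjoint_newCorner subset_rfl),
      Finset.card_image_of_injective _ shiftCol_injective]

theorem card_emptyCrossCorners_child {T : TreeLikeTableau} {B : Finset ℕ}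
    (hBC : B ⊆ T.firstCol) : (T.child B).emptyCrossCorners.card =
      (T.emptyCrossCorners.filter fun c => c.1 ∉ B).card + (T.newCorner B).card := by
  rcases B.eq_empty_or_nonempty with rfl | hB
  · simp [child_empty, emptyCrossCorners_addRow, newCorner]
  · rw [child_eq_splitCol hB hBC, emptyCrossCorners_splitCol,
      Finset.card_union_of_disjoint (disjoint_newCorner
        ((Finset.filter_subset _ _).trans T.emptyCrossCorners_subset)),
      Finset.card_image_of_injective _ shiftCol_injective]

end TreeLikeTableau


/-! ### Reflection in the diagonal -/

namespace TreeLikeTableau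

/-- The reflection of a tableau in the main diagonal. -/
def transpose (T : TreeLikeTableau) : TreeLikeTableau where
  shape := T.shape.transpose
  points := T.points.map (Equiv.prodComm ℕ ℕ).toEmbedding
  points_subset := Finset.map_subset_map.2 T.points_subset
  root_mem := Finset.mem_map.2 ⟨(0, 0), T.root_mem, rfl⟩
  parent := by
    rintro ⟨i, j⟩ hc hne
    have hm : ∀ k l, (k, l) ∈ T.points.map (Equiv.prodComm ℕ ℕ).toEmbedding ↔ (l, k) ∈ T.points :=
      fun k l => by simp
    simp only [hm] at hc ⊢
    have h := T.parent _ hc (fun h => hne (by simpa [and_comm] using h))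
    exact (xor_comm _ _).mp h
  row_pointed := by
    intro i hi
    obtain ⟨j, hj⟩ := T.col_pointed i (YoungDiagram.mem_transpose.1 hi)
    exact ⟨j, Finset.mem_map.2 ⟨_, hj, rfl⟩⟩
  col_pointed := by
    intro j hj
    obtain ⟨i, hi⟩ := T.row_pointed j (YoungDiagram.mem_transpose.1 hj)
    exact ⟨i, Finset.mem_map.2 ⟨_, hi, rfl⟩⟩

theorem mem_points_transpose {T : TreeLikeTableau} {i j : ℕ} :
    (i, j) ∈ T.transpose.points ↔ (j, i) ∈ T.points := by
  simp [transpose]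

theorem mem_shape_transpose {T : TreeLikeTableau} {i j : ℕ} :
    (i, j) ∈ T.transpose.shape ↔ (j, i) ∈ T.shape :=
  YoungDiagram.mem_transpose

theorem transpose_transpose (T : TreeLikeTableau) : T.transpose.transpose = T :=
  ext_iff_mem (fun _ _ => by rw [mem_shape_transpose, mem_shape_transpose])
    fun _ _ => by rw [mem_points_transpose, mem_points_transpose]

theorem size_transpose (T : TreeLikeTableau) : T.transpose.size = T.size :=
  Finset.card_map _

theorem left_transpose (T : TreeLikeTableau) : T.transpose.left = T.top := by
  rw [left, transpose, Finset.filter_map, Finset.card_map, top]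
  congr 1
  refine Finset.filter_congr fun c _ => and_congr_right fun _ => not_congr ?_
  simp [Prod.ext_iff, and_comm]

theorem top_transpose (T : TreeLikeTableau) : T.transpose.top = T.left := by
  rw [← left_transpose, transpose_transpose]

theorem weight_transpose {R : Type*} [CommRing R] (a b : R) (T : TreeLikeTableau) :
    T.transpose.weight a b = T.weight b a := by
  rw [weight, weight, left_transpose, top_transpose, mul_comm]

theorem swap_mem_nonOccupiedCorners_transpose {T : TreeLikeTableau} {c : ℕ × ℕ} :
    c.swap ∈ T.transpose.nonOccupiedCorners ↔ c ∈ T.nonOccupiedCorners := by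
  obtain ⟨i, j⟩ := c
  simp only [nonOccupiedCorners, corners, Finset.mem_filter, YoungDiagram.mem_cells,
    Prod.swap_prod_mk, mem_shape_transpose, mem_points_transpose]
  tauto

theorem noPointAbove_transpose {T : TreeLikeTableau} {c : ℕ × ℕ} :
    T.transpose.NoPointAbove c.swap ↔ T.NoPointLeft c := by
  simp only [NoPointAbove, NoPointLeft, Prod.fst_swap, Prod.snd_swap, mem_points_transpose]

theorem noPointLeft_transpose {T : TreeLikeTableau} {c : ℕ × ℕ} :
    T.transpose.NoPointLeft c.swap ↔ T.NoPointAbove c := by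
  simp only [NoPointAbove, NoPointLeft, Prod.fst_swap, Prod.snd_swap, mem_points_transpose]

theorem mem_NOC {n : ℕ} {x : (_ : TreeLikeTableau) × (ℕ × ℕ)} :
    x ∈ NOC n ↔ x.1.size = n ∧ x.2 ∈ x.1.nonOccupiedCorners := by
  rw [NOC, Finset.mem_sigma, mem_treeLikeTableaux]

theorem tableauPoly_comm {R : Type*} [CommRing R] (n : ℕ) (a b : R) :
    tableauPoly n a b = tableauPoly n b a := by
  refine Finset.sum_nbij' transpose transpose ?_ ?_ (fun T _ => transpose_transpose T)
    (fun T _ => transpose_transpose T) fun T _ => (weight_transpose b a T).symm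
  all_goals
    intro T hT
    rw [mem_treeLikeTableaux] at hT ⊢
    rw [size_transpose, hT]

theorem nocG_eq_nocF {R : Type*} [CommRing R] (n : ℕ) (a b : R) : nocG n a b = nocF n b a := by
  classical
  refine Finset.sum_nbij' (fun x => ⟨x.1.transpose, x.2.swap⟩) (fun x => ⟨x.1.transpose, x.2.swap⟩)
    ?_ ?_ ?_ ?_ fun x _ => (weight_transpose b a x.1).symm
  · intro x hx
    rw [NOC1b, Finset.mem_filter, mem_NOC] at hx
    rw [NOCa1, Finset.mem_filter, mem_NOC, size_transpose, swap_mem_nonOccupiedCorners_transpose,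
      noPointAbove_transpose, noPointLeft_transpose]
    exact hx
  · intro x hx
    rw [NOCa1, Finset.mem_filter, mem_NOC] at hx
    rw [NOC1b, Finset.mem_filter, mem_NOC, size_transpose, swap_mem_nonOccupiedCorners_transpose,
      noPointAbove_transpose, noPointLeft_transpose]
    exact hx
  · rintro ⟨T, c⟩ -
    simp [transpose_transpose]
  · rintro ⟨T, c⟩ -
    simp [transpose_transpose]

/-! ### Generating functions and their recurrences -/

section sums

variable {R : Type*} [CommRing R]

/-- Row `0` gives a factor `a` if chosen and `b` if not; every other row gives `1` or `b`. -/
theorem sum_powerset_pow (a b : R) {s : Finset ℕ} (h0 : 0 ∈ s) :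
    ∑ B ∈ s.powerset, a ^ (if 0 ∈ B then 1 else 0) * b ^ (s.card - B.card) =
      (a + b) * (b + 1) ^ (s.card - 1) := by
  obtain ⟨t, ht, rfl⟩ : ∃ t, 0 ∉ t ∧ s = insert 0 t :=
    ⟨s.erase 0, Finset.notMem_erase 0 s, (Finset.insert_erase h0).symm⟩
  have key := Finset.sum_pow_mul_eq_add_pow (1 : R) b t
  simp only [one_pow, one_mul] at key
  rw [Finset.sum_powerset_insert ht, Finset.card_insert_of_notMem ht, Nat.add_sub_cancel,
    add_comm b 1, ← key, add_comm a b, add_mul, Finset.mul_sum, Finset.mul_sum]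
  congr 1
  · refine Finset.sum_congr rfl fun B hB => ?_
    have hBt := Finset.mem_powerset.1 hB
    rw [if_neg fun h => ht (hBt h), pow_zero, one_mul,
      Nat.sub_add_comm (Finset.card_le_card hBt), pow_succ']
  · refine Finset.sum_congr rfl fun B hB => ?_
    have hBt := Finset.mem_powerset.1 hB
    rw [if_pos (Finset.mem_insert_self 0 B), pow_one,
      Finset.card_insert_of_notMem fun h => ht (hBt h), Nat.add_sub_add_right]

theorem sum_weight_child (a b : R) (T : TreeLikeTableau) :
    ∑ B ∈ T.firstCol.powerset, (T.child B).weight a b = (a + b) * T.weight a (b + 1) := by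
  rw [weight, mul_left_comm, left_eq, ← sum_powerset_pow a b T.zero_mem_firstCol, Finset.mul_sum]
  refine Finset.sum_congr rfl fun B hB => ?_
  have hB' := Finset.mem_powerset.1 hB
  rw [weight, top_child hB', left_child hB', pow_add, mul_assoc]

theorem tableauPoly_succ {n : ℕ} (hn : 1 ≤ n) (a b : R) :
    tableauPoly (n + 1) a b = (a + b) * tableauPoly n a (b + 1) := by
  rw [tableauPoly, sum_treeLikeTableaux_succ hn, tableauPoly, Finset.mul_sum]
  exact Finset.sum_congr rfl fun T _ => sum_weight_child a b T

open Classical in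
theorem sum_short_succ {n : ℕ} (hn : 1 ≤ n) (φ : TreeLikeTableau → R) :
    ∑ T ∈ treeLikeTableaux (n + 1), (if T.Short then φ T else 0) =
      ∑ T ∈ treeLikeTableaux n, φ T.addRow := by
  rw [sum_treeLikeTableaux_succ hn]
  refine Finset.sum_congr rfl fun T _ => ?_
  rw [Finset.sum_eq_single_of_mem ∅ (Finset.empty_mem_powerset _)]
  · rw [child_empty, if_pos (short_addRow T)]
  · intro B hB hne
    rw [if_neg]
    rwa [short_child_iff (Finset.mem_powerset.1 hB)]

open Classical in
theorem sum_short_one (φ : TreeLikeTableau → R) :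
    ∑ T ∈ treeLikeTableaux 1, (if T.Short then φ T else 0) = 0 := by
  refine Finset.sum_eq_zero fun T hT => if_neg ?_
  rintro ⟨i, hi, h, -⟩
  have := T.row_lt_size h
  rw [mem_treeLikeTableaux.1 hT] at this
  omega

theorem emptyColCorners_eq_empty {T : TreeLikeTableau} (hT : T.size = 1) :
    T.emptyColCorners = ∅ := by
  refine Finset.eq_empty_of_forall_notMem ?_
  rintro ⟨i, j⟩ h
  rw [mem_emptyColCorners] at h
  have := T.row_lt_size h.2.1.1
  omega

-- Only `B = {0}` creates a corner, and only when `T` is short.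
open Classical in
theorem sum_newCorner (T : TreeLikeTableau) (ψ : Finset ℕ → R) :
    ∑ B ∈ T.firstCol.powerset, ψ B * ((T.newCorner B).card : R) =
      if T.Short then ψ {0} else 0 := by
  rw [Finset.sum_eq_single_of_mem {0} (by simpa using T.zero_mem_firstCol)]
  · rw [card_newCorner]
    by_cases h : T.Short <;> simp [h]
  · intro B _ hB
    rw [card_newCorner, if_neg fun h => hB h.1, Nat.cast_zero, mul_zero]

theorem singleton_zero_subset (T : TreeLikeTableau) : {0} ⊆ T.firstCol := by
  simpa using T.zero_mem_firstCol

/-- The weighted number of unoccupied corners counted by `emptyColCorners`. -/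
noncomputable def colSum (n : ℕ) (a b : R) : R :=
  ∑ T ∈ treeLikeTableaux n, T.weight a b * (T.emptyColCorners.card : R)

/-- The weighted number of unoccupied corners counted by `emptyCrossCorners`, a factor `b` being
omitted. -/
noncomputable def crossSum (n : ℕ) (a b : R) : R :=
  ∑ T ∈ treeLikeTableaux n, a ^ T.top * b ^ (T.left - 1) * (T.emptyCrossCorners.card : R)

open Classical in
theorem colSum_succ {n : ℕ} (hn : 1 ≤ n) (a b : R) :
    colSum (n + 1) a b = (a + b) * colSum n a (b + 1) +
      a * ∑ T ∈ treeLikeTableaux n, if T.Short then T.weight a b else 0 := by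
  rw [colSum, sum_treeLikeTableaux_succ hn, colSum, Finset.mul_sum, Finset.mul_sum,
    ← Finset.sum_add_distrib]
  refine Finset.sum_congr rfl fun T _ => ?_
  have h : ∀ B ∈ T.firstCol.powerset,
      (T.child B).weight a b * ((T.child B).emptyColCorners.card : R) =
        (T.child B).weight a b * (T.emptyColCorners.card : R) +
          (T.child B).weight a b * ((T.newCorner B).card : R) := fun B hB => by
    rw [card_emptyColCorners_child (Finset.mem_powerset.1 hB), Nat.cast_add, mul_add]
  rw [Finset.sum_congr rfl h, Finset.sum_add_distrib, ← Finset.sum_mul, sum_weight_child,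
    mul_assoc, sum_newCorner, mul_ite, mul_zero]
  congr 2
  -- For `B = {0}`, `top` grows by one and `left` is unchanged: the weight is multiplied by `a`.
  rw [weight, top_child T.singleton_zero_subset, left_child T.singleton_zero_subset, weight,
    card_firstCol]
  simp [pow_succ']
  ring

/-- For a fixed corner, `B` ranges over the subsets of `T.firstCol` avoiding the corner's row. This
row thus always contributes `b`, with no shift to `b + 1`; leaving that factor out gives the
recurrence the same form as for `tableauPoly`. -/
theorem sum_filter_notMem (a b : R) (T : TreeLikeTableau) :
    ∑ B ∈ T.firstCol.powerset, a ^ (T.child B).top * b ^ ((T.child B).left - 1) *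
      ((T.emptyCrossCorners.filter fun c => c.1 ∉ B).card : R) =
        (a + b) * (a ^ T.top * (b + 1) ^ (T.left - 1) * (T.emptyCrossCorners.card : R)) := by
  simp only [Finset.card_filter, Nat.cast_sum, Finset.mul_sum]
  rw [Finset.sum_comm, Finset.card_eq_sum_ones, Nat.cast_sum, Finset.mul_sum, Finset.mul_sum]
  refine Finset.sum_congr rfl fun c hc => ?_
  obtain ⟨h1, h0⟩ := fst_mem_firstCol hc
  have hs : (T.firstCol.erase c.1).card = T.left := by
    rw [Finset.card_erase_of_mem h1, left_eq]
  have hf : T.firstCol.powerset.filter (fun B => c.1 ∉ B) = (T.firstCol.erase c.1).powerset := by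
    ext B
    rw [Finset.mem_filter, Finset.mem_powerset, Finset.mem_powerset, Finset.subset_erase]
  -- The corner's row is not row `0`, so `0` is still available after erasing it.
  have key := sum_powerset_pow a b (Finset.mem_erase.2 ⟨h0.ne, T.zero_mem_firstCol⟩)
  rw [hs, ← hf] at key
  simp only [Nat.cast_ite, Nat.cast_one, Nat.cast_zero, mul_ite, mul_one, mul_zero]
  rw [mul_left_comm (a + b), ← key, ← Finset.sum_filter, Finset.mul_sum]
  refine Finset.sum_congr rfl fun B hB => ?_
  have hB' := Finset.mem_powerset.1 (Finset.mem_filter.1 hB).1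
  rw [top_child hB', left_child hB', pow_add, mul_assoc, left_eq, Nat.sub_right_comm]

open Classical in
theorem crossSum_succ {n : ℕ} (hn : 1 ≤ n) (a b : R) :
    crossSum (n + 1) a b = (a + b) * crossSum n a (b + 1) +
      a * ∑ T ∈ treeLikeTableaux n, if T.Short then a ^ T.top * b ^ (T.left - 1) else 0 := by
  rw [crossSum, sum_treeLikeTableaux_succ hn, crossSum, Finset.mul_sum, Finset.mul_sum,
    ← Finset.sum_add_distrib]
  refine Finset.sum_congr rfl fun T _ => ?_
  have h : ∀ B ∈ T.firstCol.powerset, a ^ (T.child B).top * b ^ ((T.child B).left - 1) *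
      ((T.child B).emptyCrossCorners.card : R) =
        a ^ (T.child B).top * b ^ ((T.child B).left - 1) *
          ((T.emptyCrossCorners.filter fun c => c.1 ∉ B).card : R) +
        a ^ (T.child B).top * b ^ ((T.child B).left - 1) * ((T.newCorner B).card : R) :=
    fun B hB => by
      rw [card_emptyCrossCorners_child (Finset.mem_powerset.1 hB), Nat.cast_add, mul_add]
  rw [Finset.sum_congr rfl h, Finset.sum_add_distrib, sum_filter_notMem,
    sum_newCorner T fun B => a ^ (T.child B).top * b ^ ((T.child B).left - 1), mul_ite, mul_zero]
  congr 2
  rw [top_child T.singleton_zero_subset, left_child T.singleton_zero_subset, card_firstCol]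
  simp [pow_succ']
  ring

theorem colSum_one (a b : R) : colSum 1 a b = 0 :=
  Finset.sum_eq_zero fun T hT => by
    rw [emptyColCorners_eq_empty (mem_treeLikeTableaux.1 hT), Finset.card_empty, Nat.cast_zero,
      mul_zero]

theorem crossSum_one (a b : R) : crossSum 1 a b = 0 :=
  Finset.sum_eq_zero fun T hT => by
    have h := T.emptyCrossCorners_subset
    rw [emptyColCorners_eq_empty (mem_treeLikeTableaux.1 hT), Finset.subset_empty] at h
    rw [h, Finset.card_empty, Nat.cast_zero, mul_zero]

theorem colSum_add_three (n : ℕ) (a b : R) :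
    colSum (n + 3) a b = (a + b) * colSum (n + 2) a (b + 1) + a * b * tableauPoly (n + 1) a b := by
  rw [colSum_succ (by omega), sum_short_succ (by omega), tableauPoly, mul_assoc, Finset.mul_sum _ _ b]
  congr 3
  ext T
  rw [weight, weight, top_addRow, left_addRow, pow_succ]
  ring

theorem crossSum_add_three (n : ℕ) (a b : R) :
    crossSum (n + 3) a b = (a + b) * crossSum (n + 2) a (b + 1) + a * tableauPoly (n + 1) a b := by
  rw [crossSum_succ (by omega), sum_short_succ (by omega), tableauPoly]
  congr 3
  ext T
  rw [weight, top_addRow, left_addRow, Nat.add_sub_cancel]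

/-- The shift `b ↦ b + 1` adds `n` to `n b + n.choose 2` and the new corners add `b`; Pascal's rule
does the rest. -/
theorem colSum_add_two (n : ℕ) (a b : R) :
    colSum (n + 2) a b = a * (n * b + (n.choose 2 : R)) * tableauPoly n a b := by
  induction n generalizing b with
  | zero =>
    rw [colSum_succ le_rfl, colSum_one, sum_short_one]
    simp
  | succ n ih =>
    rw [colSum_add_three, ih]
    -- The recurrence for `tableauPoly` fails from size `0` to size `1`, but there its coefficient
    -- vanishes.
    rcases Nat.eq_zero_or_pos n with rfl | hn
    · simp
    · rw [tableauPoly_succ hn, Nat.choose_succ_succ' n 1, Nat.choose_one_right]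
      push_cast
      ring

theorem crossSum_add_two (n : ℕ) (a b : R) :
    crossSum (n + 2) a b = a * n * tableauPoly n a b := by
  induction n generalizing b with
  | zero =>
    rw [crossSum_succ le_rfl, crossSum_one, sum_short_one]
    simp
  | succ n ih =>
    rw [crossSum_add_three, ih]
    rcases Nat.eq_zero_or_pos n with rfl | hn
    · simp
    · rw [tableauPoly_succ hn]
      push_cast
      ring

/-- Such a corner forces a non-root point in the first column, so the truncated exponent `T.left -
1` is exact whenever the count is nonzero. -/
theorem weight_mul_card_emptyCrossCorners (a b : R) (T : TreeLikeTableau) :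
    T.weight a b * (T.emptyCrossCorners.card : R) =
      b * (a ^ T.top * b ^ (T.left - 1) * (T.emptyCrossCorners.card : R)) := by
  rcases T.emptyCrossCorners.eq_empty_or_nonempty with h | ⟨c, hc⟩
  · simp [h]
  · obtain ⟨h1, h0⟩ := fst_mem_firstCol hc
    have hlt : 1 < T.firstCol.card :=
      Finset.one_lt_card.2 ⟨0, T.zero_mem_firstCol, c.1, h1, h0.ne⟩
    obtain ⟨l, hl⟩ : ∃ l, T.left = l + 1 :=
      Nat.exists_eq_succ_of_ne_zero (by rw [left_eq]; omega)
    rw [weight, hl, Nat.add_sub_cancel, pow_succ]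
    ring

theorem nocF_eq (n : ℕ) (a b : R) : nocF n a b = colSum n a b - b * crossSum n a b := by
  classical
  rw [nocF, NOCa1, Finset.sum_filter, NOC, Finset.sum_sigma, colSum, crossSum, Finset.mul_sum,
    ← Finset.sum_sub_distrib]
  refine Finset.sum_congr rfl fun T _ => ?_
  have h : T.emptyColCorners.card = T.emptyCrossCorners.card +
      (T.emptyColCorners.filter fun c => ¬T.NoPointLeft c).card := by
    rw [emptyCrossCorners]
    exact (Finset.card_filter_add_card_filter_not _).symm
  rw [← weight_mul_card_emptyCrossCorners, h, Nat.cast_add, mul_add, add_sub_cancel_left,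
    ← Finset.sum_filter, emptyColCorners, Finset.filter_filter]
  refine (Finset.sum_const (T.weight a b)).trans ?_
  rw [nsmul_eq_mul, mul_comm]

theorem nocF_add_two (n : ℕ) (a b : R) :
    nocF (n + 2) a b = (n.choose 2 : R) * a * tableauPoly n a b := by
  rw [nocF_eq, colSum_add_two, crossSum_add_two]
  ring

end sums

end TreeLikeTableau

theorem mainTheorem7 {R : Type*} [CommRing R] (a b : R) (n : ℕ) (hn : 3 ≤ n) :
    nocF n a b = (Nat.choose (n - 2) 2 : R) * a * tableauPoly (n - 2) a b ∧
    nocG n a b = (Nat.choose (n - 2) 2 : R) * b * tableauPoly (n - 2) a b := by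
  obtain ⟨m, rfl⟩ : ∃ m, n = m + 2 := ⟨n - 2, by omega⟩
  rw [Nat.add_sub_cancel]
  refine ⟨TreeLikeTableau.nocF_add_two m a b, ?_⟩
  rw [TreeLikeTableau.nocG_eq_nocF, TreeLikeTableau.nocF_add_two,
    TreeLikeTableau.tableauPoly_comm]
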